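/- Let $H$ be an infinite-dimensional separable complex Hilbert space and let $T$ be a bounded linear operator on $H$. Let $W_{\rm e}(T)$ denote the essential numerical range of $T$, i.e. the set of all $\lambda\in\mathbb C$ for which there is an orthonormal sequence $(x_k)_{k=1}^\infty$ in $H$ with $\lim_{k\to\infty}\langle Tx_k,x_k\rangle=\lambda$, and let $\mathcal D(T)$ denote the set of diagonals of $T$, i.e. the set of all sequences $(\langle Te_k,e_k\rangle)_{k=1}^\infty$, where $(e_k)_{k=1}^\infty$ runs through all orthonormal bases of $H$. Write $\mathbb D=\{z\in\mathbb C:|z|<1\}$. Suppose that $\|T\|\le 1$, that $W_{\rm e}(T)=\overline{\mathbb D}$, and that $T$ is not a Fredholm operator of index $0$. Let $(\lambda_k)_{k=1}^\infty\subset\mathbb D$. Then $$(\lambda_k)_{k=1}^\infty\in\mathcal D(T)\iff\sum_{k=1}^\infty(1-|\lambda_k|)=\infty.$$ -/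

import Mathlib

open Filter Topology

noncomputable section

namespace OperatorDiagonals

variable {H : Type*} [NormedAddCommGroup H] [InnerProductSpace ℂ H]

/-- The essential numerical range `W_e(T)`: all limits of `⟨T x_k, x_k⟩` along orthonormal
sequences `(x_k)`. Mathlib's inner product is linear in the second variable, so the
number `⟨T x, x⟩` (linear in the first variable) is `inner ℂ x (T x)`. -/
def essNumericalRange (T : H →L[ℂ] H) : Set ℂ :=
  {μ | ∃ x : ℕ → H, Orthonormal ℂ x ∧
    Tendsto (fun k => inner ℂ (x k) (T (x k))) atTop (𝓝 μ)}

/-- The set `𝒟(T)` of diagonals of `T`: all sequences `(⟨T e_k, e_k⟩)_k`, where `(e_k)` runs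
through the orthonormal bases of `H`. -/
def diagonals (T : H →L[ℂ] H) : Set (ℕ → ℂ) :=
  {d | ∃ e : HilbertBasis ℕ ℂ H, ∀ k, inner ℂ (e k) (T (e k)) = d k}

/-- The index `dim ker T - codim ran T`; meaningful when `T` is Fredholm, where both
dimensions are finite. -/
def fredholmIndex (T : H →L[ℂ] H) : ℤ :=
  (Module.finrank ℂ T.ker : ℤ) - (Module.finrank ℂ (H ⧸ T.range) : ℤ)

end OperatorDiagonals

end

open Filter Topology

namespace OperatorDiagonals

/-! Necessity: if the `1 - ‖d k‖` are summable, then `T` differs by a Hilbert–Schmidt operator from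
a unitary `U` that is diagonal in the given basis, so `T` is Fredholm of index zero
(`isFredholm_index_zero_of_summable`).

Sufficiency: every point of the open disc is attained as `⟨Tv, v⟩` by a unit vector orthogonal to
any given finite-dimensional subspace (`exists_unit_orthogonal_inner_eq`). The basis is built
greedily with prescribed diagonal; the vector `e k` can also capture a share `(1 - ‖d k‖) / 4` of
the squared norm of the part of a target vector not yet spanned
(`exists_unit_orthogonal_inner_eq_and_le`). Each term of a dense sequence is made the target along a
set of steps where `1 - ‖d k‖` still has divergent sum, which forces completeness. -/

/-! ### Necessity: Hilbert–Schmidt perturbations of a unitary have index zero. -/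

/-- Since `B` is the identity modulo `R`, its restriction to `R` has the same kernel and an
isomorphic cokernel; rank–nullity on `R` concludes. -/
theorem finrank_ker_eq_finrank_quotient_range_of_sub_mem {K V : Type*} [Field K]
    [AddCommGroup V] [Module K V] (B : V →ₗ[K] V) (R : Submodule K V) [FiniteDimensional K R]
    (h : ∀ x, B x - x ∈ R) :
    Module.finrank K (LinearMap.ker B) = Module.finrank K (V ⧸ LinearMap.range B) := by
  have hmaps : ∀ x ∈ R, B x ∈ R := fun x hx => by
    simpa using R.add_mem (h x) hx
  set C : R →ₗ[K] R := B.restrict hmaps with hC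
  have hker : Module.finrank K (LinearMap.ker C) = Module.finrank K (LinearMap.ker B) := by
    have hle : LinearMap.ker B ≤ R := fun x hx => by
      have := R.neg_mem (h x)
      rw [LinearMap.mem_ker.1 hx] at this
      simpa using this
    have : LinearMap.ker C = (LinearMap.ker B).comap R.subtype := by
      ext x
      simp [hC, LinearMap.restrict_apply, Subtype.ext_iff]
    rw [this]
    exact (Submodule.comapSubtypeEquivOfLe hle).finrank_eq
  have hrange : LinearMap.range C = (LinearMap.range B).comap R.subtype := by
    ext ⟨y, hy⟩
    constructor
    · rintro ⟨x, hx⟩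
      exact ⟨x, congrArg Subtype.val hx⟩
    · rintro ⟨x, hx⟩
      have hx' : B x = y := hx
      have hxR : x ∈ R := by
        have := R.sub_mem hy (hx' ▸ h x)
        simpa using this
      exact ⟨⟨x, hxR⟩, Subtype.ext hx⟩
  have hsup : R ⊔ LinearMap.range B = ⊤ := by
    rw [eq_top_iff]
    intro x _
    have : x = -(B x - x) + B x := by abel
    rw [this]
    exact Submodule.add_mem_sup (R.neg_mem (h x)) ⟨x, rfl⟩
  have hcomp : Function.Surjective ((LinearMap.range B).mkQ ∘ₗ R.subtype) := by
    rw [← LinearMap.range_eq_top, LinearMap.range_comp, Submodule.range_subtype]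
    have := congrArg (Submodule.map (LinearMap.range B).mkQ) hsup
    rw [Submodule.map_sup, Submodule.map_top, Submodule.range_mkQ] at this
    simpa using this
  have e2 : (R ⧸ LinearMap.range C) ≃ₗ[K] (V ⧸ LinearMap.range B) := by
    have hk : LinearMap.ker ((LinearMap.range B).mkQ ∘ₗ R.subtype) = LinearMap.range C := by
      rw [LinearMap.ker_comp, Submodule.ker_mkQ, hrange]
    exact (Submodule.quotEquivOfEq _ _ hk.symm).trans (LinearMap.quotKerEquivOfSurjective _ hcomp)
  have h1 := LinearMap.finrank_range_add_finrank_ker C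
  have h2 := Submodule.finrank_quotient_add_finrank (LinearMap.range C)
  rw [← hker, ← e2.finrank_eq]
  omega

variable {H : Type*} [NormedAddCommGroup H] [InnerProductSpace ℂ H]

/-- An operator that agrees with an invertible operator on a closed subspace of finite codimension
is Fredholm of index zero. -/
theorem isFredholm_and_fredholmIndex_eq_zero [CompleteSpace H] (T : H →L[ℂ] H) (S : H ≃L[ℂ] H)
    (F : Submodule ℂ H) [FiniteDimensional ℂ F] (h : ∀ x ∈ Fᗮ, T x = S x) :
    T.IsFredholm ∧ fredholmIndex T = 0 := by
  have hco : (Fᗮ).CoFG := by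
    exact Submodule.FG.cofg_of_isCompl (Submodule.isCompl_orthogonal F)
      ((Submodule.fg_iff_finiteDimensional F).2 inferInstance)
  constructor
  · let F₁ : Submodule ℂ H := (Fᗮ).map (S : H →ₗ[ℂ] H)
    have hF₁ : IsClosed (F₁ : Set H) := by
      have := S.toHomeomorph.isClosedMap _ (Submodule.isClosed_orthogonal F)
      simpa [F₁] using this
    have hF₁co : F₁.CoFG :=
      Module.Finite.equiv (Submodule.Quotient.equiv Fᗮ F₁ S.toLinearEquiv rfl)
    have hm : Set.MapsTo T (Fᗮ : Submodule ℂ H) F₁ := fun x hx => ⟨x, hx, (h x hx).symm⟩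
    refine ContinuousLinearMap.IsFredholm.of_isInvertible_restrict
      (Submodule.isClosed_orthogonal F) hF₁ hm ?_
    refine ⟨S.submoduleMap Fᗮ, ?_⟩
    ext x
    exact (h x x.2).symm
  -- `T S⁻¹ - 1` vanishes on `S Fᗮ`, so its range is the finite-dimensional `(T - S) F`.
  · let B : H →ₗ[ℂ] H := T.toLinearMap ∘ₗ S.symm.toLinearEquiv.toLinearMap
    let R : Submodule ℂ H := F.map (T - S : H →L[ℂ] H).toLinearMap
    have hB := finrank_ker_eq_finrank_quotient_range_of_sub_mem B R (fun x => by
      obtain ⟨y, rfl⟩ := S.surjective x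
      refine ⟨F.starProjection y, by simp, ?_⟩
      have : T (y - F.starProjection y) = S (y - F.starProjection y) := h _ (by simp)
      simp only [map_sub] at this
      simp only [B, LinearMap.coe_comp, Function.comp_apply, ContinuousLinearMap.coe_coe,
        sub_apply, LinearEquiv.coe_coe,
        ContinuousLinearEquiv.coe_toLinearEquiv, ContinuousLinearEquiv.symm_apply_apply,
        ContinuousLinearEquiv.coe_coe]
      rw [sub_eq_sub_iff_sub_eq_sub, ← neg_inj, neg_sub, neg_sub, this])
    have hk : Module.finrank ℂ T.ker = Module.finrank ℂ (LinearMap.ker B) := by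
      have : LinearMap.ker B = T.ker.map S.toLinearEquiv.toLinearMap := by
        rw [LinearMap.ker_comp]
        exact (Submodule.map_equiv_eq_comap_symm S.toLinearEquiv T.ker).symm
      rw [this, LinearEquiv.finrank_map_eq]
    have hr : LinearMap.range B = T.range := by
      simp [B, LinearMap.range_comp]
    rw [fredholmIndex, hk, hB, hr, sub_self]

/-- Cauchy–Schwarz and Bessel bound `A` by the square root of a Hilbert–Schmidt tail, here at most
`1 / 4`. -/
theorem exists_norm_le_half_of_summable_sq (e : HilbertBasis ℕ ℂ H) (A : H →L[ℂ] H)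
    (hA : Summable fun k => ‖A (e k)‖ ^ 2) :
    ∃ N : ℕ, ∀ x : H, (∀ k < N, inner ℂ (e k) x = 0) → ‖A x‖ ≤ 1 / 2 * ‖x‖ := by
  obtain ⟨s, hs⟩ := summable_iff_vanishing_norm.1 hA (1 / 4) (by norm_num)
  obtain ⟨N, hN⟩ := s.exists_nat_subset_range
  refine ⟨N, fun x hx => ?_⟩
  have hsum : HasSum (fun k => inner ℂ (e k) x • A (e k)) (A x) := by
    have := (e.hasSum_repr x).mapL A
    simpa [e.repr_apply_apply] using this
  refine le_of_tendsto (hsum.tendsto_sum_nat.norm) (Eventually.of_forall fun n => ?_)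
  have hfil : ∑ k ∈ Finset.range n, inner ℂ (e k) x • A (e k)
      = ∑ k ∈ Finset.range n \ Finset.range N, inner ℂ (e k) x • A (e k) := by
    refine (Finset.sum_subset Finset.sdiff_subset fun k hk hk' => ?_).symm
    have : k < N := by
      by_contra hcon
      exact hk' (Finset.mem_sdiff.2 ⟨hk, by simpa using hcon⟩)
    rw [hx k this, zero_smul]
  rw [hfil]
  set t := Finset.range n \ Finset.range N
  have ht : ∑ k ∈ t, ‖A (e k)‖ ^ 2 ≤ 1 / 4 := by
    have := hs t (Finset.disjoint_left.2 fun k hk hks => (Finset.mem_sdiff.1 hk).2 (hN hks))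
    exact (le_abs_self _).trans this.le
  have hb : ∑ k ∈ t, ‖inner ℂ (e k) x‖ ^ 2 ≤ ‖x‖ ^ 2 := e.orthonormal.sum_inner_products_le x
  have hcs := Finset.sum_mul_sq_le_sq_mul_sq t (fun k => ‖inner ℂ (e k) x‖) (fun k => ‖A (e k)‖)
  have hnorm : ‖∑ k ∈ t, inner ℂ (e k) x • A (e k)‖ ≤ ∑ k ∈ t, ‖inner ℂ (e k) x‖ * ‖A (e k)‖ :=
    (norm_sum_le _ _).trans_eq (by simp only [norm_smul])
  refine hnorm.trans (abs_le_of_sq_le_sq' ?_ (by positivity)).2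
  calc _ ≤ _ := hcs
    _ ≤ ‖x‖ ^ 2 * (1 / 4) := by gcongr
    _ = _ := by ring

/-- A unimodular number `u` with `conj u * z = ‖z‖`. -/
theorem exists_norm_eq_one_conj_mul_eq_norm (z : ℂ) :
    ∃ u : ℂ, ‖u‖ = 1 ∧ (starRingEnd ℂ) u * z = ‖z‖ := by
  rcases eq_or_ne z 0 with rfl | hz
  · exact ⟨1, by simp⟩
  · refine ⟨z / ‖z‖, by simp [hz], ?_⟩
    have : (‖z‖ : ℂ) ≠ 0 := by simpa using hz
    rw [map_div₀, Complex.conj_ofReal]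
    field_simp
    rw [mul_comm, Complex.mul_conj, Complex.normSq_eq_norm_sq]
    push_cast; ring

/-- Rescaling an orthonormal basis by unimodular factors gives a unitary operator. -/
theorem exists_unitary_diagonal [CompleteSpace H] (e : HilbertBasis ℕ ℂ H) (u : ℕ → ℂ)
    (hu : ∀ k, ‖u k‖ = 1) : ∃ U : H ≃ₗᵢ[ℂ] H, ∀ k, U (e k) = u k • e k := by
  have hne : ∀ k, u k ≠ 0 := fun k h => by simpa [h] using hu k
  have ho : Orthonormal ℂ fun k => u k • e k := by
    rw [orthonormal_iff_ite]
    intro i j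
    have := orthonormal_iff_ite.1 e.orthonormal i j
    rw [inner_smul_left, inner_smul_right, this]
    split_ifs with hij
    · subst hij
      rw [mul_one, mul_comm, Complex.mul_conj, Complex.normSq_eq_norm_sq, hu]
      simp
    · simp
  have hspan : ⊤ ≤ (Submodule.span ℂ (Set.range fun k => u k • e k)).topologicalClosure := by
    rw [← e.dense_span]
    refine Submodule.topologicalClosure_mono (Submodule.span_le.2 ?_)
    rintro _ ⟨k, rfl⟩
    have h1 : u k • e k ∈ Submodule.span ℂ (Set.range fun k => u k • e k) :=
      Submodule.subset_span ⟨k, rfl⟩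
    have h2 := Submodule.smul_mem _ (u k)⁻¹ h1
    rwa [smul_smul, inv_mul_cancel₀ (hne k), one_smul] at h2
  let f := HilbertBasis.mk ho hspan
  refine ⟨e.repr.trans f.repr.symm, fun k => ?_⟩
  simp [e.repr_self, f.repr_symm_single, f]

/-- With `u k` the phase of the diagonal entry, `‖T e_k - u k e_k‖² ≤ 2 (1 - ‖⟨T e_k, e_k⟩‖)`, so `A
= T - U` is Hilbert–Schmidt. Cutting `A` off to `Fᗮ` makes it small, and `S = U + A Q` is then
invertible and agrees with `T` on `Fᗮ`. -/
theorem isFredholm_index_zero_of_summable [CompleteSpace H] (T : H →L[ℂ] H) (hT : ‖T‖ ≤ 1)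
    (e : HilbertBasis ℕ ℂ H) (hs : Summable fun k => 1 - ‖inner ℂ (e k) (T (e k))‖) :
    T.IsFredholm ∧ fredholmIndex T = 0 := by
  choose u hu hu' using fun k => exists_norm_eq_one_conj_mul_eq_norm (inner ℂ (e k) (T (e k)))
  obtain ⟨U, hU⟩ := exists_unitary_diagonal e u hu
  let A : H →L[ℂ] H := T - (U.toContinuousLinearEquiv : H →L[ℂ] H)
  have hAe : ∀ k, ‖A (e k)‖ ^ 2 ≤ 2 * (1 - ‖inner ℂ (e k) (T (e k))‖) := fun k => by
    have hek : ‖e k‖ = 1 := e.orthonormal.1 k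
    have h1 : A (e k) = T (e k) - u k • e k := by simp [A, hU]
    have h2 : ‖T (e k)‖ ≤ 1 := by
      simpa [hek] using T.le_of_opNorm_le hT (e k)
    have h3 : RCLike.re (inner ℂ (T (e k)) (u k • e k)) = ‖inner ℂ (e k) (T (e k))‖ := by
      rw [← inner_re_symm, inner_smul_left, hu']
      simp
    rw [h1, @norm_sub_sq ℂ, h3, norm_smul, hu, hek]
    nlinarith [norm_nonneg (T (e k))]
  have hsum : Summable fun k => ‖A (e k)‖ ^ 2 :=
    Summable.of_nonneg_of_le (fun _ => by positivity) hAe (hs.mul_left 2)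
  obtain ⟨N, hN⟩ := exists_norm_le_half_of_summable_sq e A hsum
  let F : Submodule ℂ H := Submodule.span ℂ (e '' (Set.Iio N))
  have hFfin : FiniteDimensional ℂ F :=
    FiniteDimensional.span_of_finite ℂ ((Set.finite_Iio N).image _)
  let Q : H →L[ℂ] H := Fᗮ.starProjection
  have hQ : ∀ x, ‖A (Q x)‖ ≤ 1 / 2 * ‖x‖ := fun x => by
    refine (hN (Q x) fun k hk => ?_).trans ?_
    · exact (Submodule.mem_orthogonal F (Q x)).1 (Fᗮ.starProjection_apply_mem x) _
        (Submodule.subset_span ⟨k, hk, rfl⟩)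
    · gcongr
      exact Fᗮ.norm_starProjection_apply_le x
  let t : H →L[ℂ] H := -((U.symm.toContinuousLinearEquiv : H →L[ℂ] H) ∘L A ∘L Q)
  have ht : ‖t‖ < 1 := by
    refine lt_of_le_of_lt (ContinuousLinearMap.opNorm_le_bound _ (by norm_num : (0:ℝ) ≤ 1 / 2)
      fun x => ?_) (by norm_num)
    simpa [t] using hQ x
  let S : H ≃L[ℂ] H :=
    (ContinuousLinearEquiv.unitsEquiv ℂ H (Units.oneSub t ht)).trans U.toContinuousLinearEquiv
  refine isFredholm_and_fredholmIndex_eq_zero T S F fun x hx => ?_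
  have hQx : Q x = x := Submodule.starProjection_eq_self_iff.2 hx
  have : S x = U ((1 - t) x) := rfl
  rw [this]
  simp [t, hQx, A]

/-! ### Splitting a divergent series into infinitely many divergent ones. -/

/-- Cut the indices into blocks on which the partial sums lie in `[2j, 2j + 2)`. As terms are at
most 1, each block has sum at least 1, and `Nat.unpair` gives every label `i` infinitely many
blocks. -/
theorem exists_forall_not_summable_indicator_fiber (a : ℕ → ℝ) (h0 : ∀ n, 0 ≤ a n)
    (h1 : ∀ n, a n ≤ 1) (ha : Tendsto (fun n => ∑ k ∈ Finset.range n, a k) atTop atTop) :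
    ∃ m : ℕ → ℕ, ∀ i, ¬ Summable (Set.indicator {n | m n = i} a) := by
  set S : ℕ → ℝ := fun n => ∑ k ∈ Finset.range n, a k with hS
  have hmono : Monotone S := fun p q hpq =>
    Finset.sum_le_sum_of_subset_of_nonneg (Finset.range_mono hpq) fun k _ _ => h0 k
  refine ⟨fun n => (Nat.unpair ⌊S n / 2⌋₊).1, fun i hsum => ?_⟩
  obtain ⟨s, hs⟩ := summable_iff_vanishing_norm.1 hsum 1 one_pos
  obtain ⟨K, hK⟩ := s.exists_nat_subset_range
  obtain ⟨r, hr⟩ := exists_nat_gt (S K)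
  -- A block with label `i` lying beyond `K`, to contradict the Cauchy criterion.
  obtain ⟨j, hj, hij⟩ : ∃ j : ℕ, S K < 2 * (j : ℝ) ∧ (Nat.unpair j).1 = i := by
    refine ⟨Nat.pair i r, ?_, by simp⟩
    have : (r : ℝ) ≤ Nat.pair i r := by exact_mod_cast Nat.right_le_pair i r
    have h0r : (0 : ℝ) ≤ r := by positivity
    linarith
  have hex : ∀ c : ℝ, ∃ n, c ≤ S n := fun c => (ha.eventually_ge_atTop c).exists
  classical
  set p := Nat.find (hex (2 * j)) with hp
  set q := Nat.find (hex (2 * j + 2)) with hq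
  have hpS : 2 * (j : ℝ) ≤ S p := Nat.find_spec (hex (2 * j))
  have hqS : 2 * (j : ℝ) + 2 ≤ S q := Nat.find_spec (hex (2 * j + 2))
  have hpq : p ≤ q := Nat.find_min' _ (by linarith)
  have hpS' : S p ≤ 2 * (j : ℝ) + 1 := by
    rcases Nat.eq_zero_or_pos p with h | h
    · rw [h]
      simp only [hS, Finset.range_zero, Finset.sum_empty]
      positivity
    · have h2 := Nat.find_min (hex (2 * j)) (Nat.sub_lt h one_pos)
      have h3 : S p = S (p - 1) + a (p - 1) := by
        conv_lhs => rw [← Nat.sub_add_cancel h]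
        exact Finset.sum_range_succ _ _
      linarith [h1 (p - 1), not_le.1 h2]
  have hKp : K ≤ p := by
    by_contra hcon
    linarith [hmono (not_le.1 hcon).le]
  have hval : ∑ k ∈ Finset.Ico p q, Set.indicator {n | (Nat.unpair ⌊S n / 2⌋₊).1 = i} a k
      = S q - S p := by
    rw [← Finset.sum_Ico_eq_sub a hpq]
    refine Finset.sum_congr rfl fun k hk => Set.indicator_of_mem ?_ a
    obtain ⟨hk1, hk2⟩ := Finset.mem_Ico.1 hk
    have hk3 := hmono hk1
    have hk4 := not_le.1 (Nat.find_min (hex (2 * j + 2)) hk2)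
    have : ⌊S k / 2⌋₊ = j := by
      rw [Nat.floor_eq_iff (by linarith [hpS, (by positivity : (0:ℝ) ≤ j)])]
      constructor <;> linarith
    change (Nat.unpair ⌊S k / 2⌋₊).1 = i
    rw [this, hij]
  have hlt := hs (Finset.Ico p q) (Finset.disjoint_left.2 fun k hk hks => by
    have := Finset.mem_range.1 (hK hks)
    have := (Finset.mem_Ico.1 hk).1
    omega)
  rw [hval] at hlt
  have := (le_abs_self _).trans_lt hlt
  linarith

/-! ### Attaining interior points of the essential numerical range. -/

/-- A point well inside the convex hull of finitely many points stays in the convex hull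
after a small perturbation of these points. -/
theorem mem_convexHull_range_of_perturbation {E ι : Type*} [NormedAddCommGroup E]
    [NormedSpace ℝ E] [Finite ι] [Nonempty ι] {z w : ι → E} {μ : E} {ε : ℝ} (hε : 0 < ε)
    (hball : Metric.closedBall μ ε ⊆ convexHull ℝ (Set.range z))
    (hzw : ∀ i, ‖w i - z i‖ ≤ ε / 2) : μ ∈ convexHull ℝ (Set.range w) := by
  by_contra hμ
  obtain ⟨f, u, hfμ, hf⟩ := geometric_hahn_banach_point_closed (convex_convexHull ℝ (Set.range w))
    ((Set.finite_range w).isClosed_convexHull ℝ) hμ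
  have hfw : ∀ i, u < f (w i) := fun i => hf _ (subset_convexHull ℝ _ ⟨i, rfl⟩)
  have hf0 : 0 < ‖f‖ := by
    rw [norm_pos_iff]
    rintro rfl
    obtain ⟨i⟩ := ‹Nonempty ι›
    have := hfw i
    simp at this hfμ
    linarith
  obtain ⟨x, hx1, hx⟩ := f.exists_lt_apply_of_lt_opNorm (half_lt_self hf0)
  obtain ⟨x, hx1, hx⟩ : ∃ x : E, ‖x‖ < 1 ∧ ‖f‖ / 2 < f x := by
    rcases abs_cases (f x) with h | h
    · exact ⟨x, hx1, by rwa [Real.norm_eq_abs, h.1] at hx⟩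
    · exact ⟨-x, by rwa [norm_neg], by rwa [Real.norm_eq_abs, h.1, ← map_neg] at hx⟩
  -- At this point of the ball `f` is below `u - ‖f‖ * (ε / 2)`, a lower bound for `f` on the hull
  -- of the `z i`.
  have hp : μ - ε • x ∈ convexHull ℝ (Set.range z) := by
    refine hball ?_
    rw [Metric.mem_closedBall, dist_eq_norm, sub_sub_cancel_left, norm_neg, norm_smul,
      Real.norm_of_nonneg hε.le]
    nlinarith
  have hsub : convexHull ℝ (Set.range z) ⊆ {y | u - ‖f‖ * (ε / 2) ≤ f y} := by
    refine convexHull_min ?_ (convex_halfSpace_ge f.toLinearMap.isLinear _)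
    rintro _ ⟨i, rfl⟩
    have h1 : f (w i - z i) ≤ ‖f‖ * (ε / 2) :=
      (le_abs_self _).trans ((f.le_opNorm _).trans (by gcongr; exact hzw i))
    rw [map_sub] at h1
    have := hfw i
    simp only [Set.mem_ofPred_eq]
    linarith
  have h1 : u - ‖f‖ * (ε / 2) ≤ f (μ - ε • x) := hsub hp
  rw [map_sub, map_smul, smul_eq_mul] at h1
  nlinarith

/-- By Bessel, orthonormal sequences tend weakly to zero, and finite-rank operators turn this into
norm convergence. -/
theorem tendsto_starProjection_of_orthonormal (F : Submodule ℂ H) [FiniteDimensional ℂ F]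
    {x : ℕ → H} (hx : Orthonormal ℂ x) :
    Tendsto (fun k => F.starProjection (x k)) atTop (𝓝 0) := by
  let b := stdOrthonormalBasis ℂ F
  have hw : ∀ y : H, Tendsto (fun k => inner ℂ y (x k)) atTop (𝓝 0) := fun y => by
    have h := (hx.inner_products_summable y).tendsto_atTop_zero
    rw [tendsto_zero_iff_norm_tendsto_zero]
    have h2 := h.sqrt
    simpa [Real.sqrt_sq, norm_inner_symm] using h2
  have : ∀ k, F.starProjection (x k) = ∑ i, inner ℂ (b i : H) (x k) • (b i : H) := fun k => by
    rw [Submodule.starProjection_apply, b.orthogonalProjectionOnto_apply_eq_sum]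
    simp
  simp_rw [this]
  rw [show (0 : H) = ∑ i, (0 : ℂ) • (b i : H) by simp]
  exact tendsto_finsetSum _ fun i _ => (hw _).smul_const _

theorem exists_unit_orthogonal_near (T : H →L[ℂ] H) {z : ℂ} (hz : z ∈ essNumericalRange T)
    (F : Submodule ℂ H) [FiniteDimensional ℂ F] {ε : ℝ} (hε : 0 < ε) :
    ∃ v ∈ Fᗮ, ‖v‖ = 1 ∧ ‖inner ℂ v (T v) - z‖ < ε := by
  obtain ⟨x, hx, hlim⟩ := hz
  have hp := tendsto_starProjection_of_orthonormal F hx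
  set w : ℕ → H := fun k => x k - F.starProjection (x k) with hw
  have hwF : ∀ k, w k ∈ Fᗮ := fun k => by simp [hw]
  have hnorm : Tendsto (fun k => ‖w k‖) atTop (𝓝 1) := by
    have h1 : Tendsto (fun k => ‖w k‖ - ‖x k‖) atTop (𝓝 0) := by
      refine squeeze_zero_norm (fun k => ?_) (by simpa using hp.norm)
      have := abs_norm_sub_norm_le (w k) (x k)
      simpa [hw] using this
    have := h1.add_const 1
    simpa [hx.1] using this
  have hin : Tendsto (fun k => inner ℂ (w k) (T (w k))) atTop (𝓝 z) := by
    have h1 : Tendsto (fun k => inner ℂ (w k) (T (w k)) - inner ℂ (x k) (T (x k)))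
        atTop (𝓝 0) := by
      have hb : Tendsto (fun k => ‖F.starProjection (x k)‖ * ‖T‖ + ‖w k‖ * ‖T (F.starProjection (x k))‖)
          atTop (𝓝 0) := by
        have h2 := (hp.norm.mul_const ‖T‖).add
          (hnorm.mul ((T.continuous.tendsto 0).comp hp).norm)
        simpa using h2
      refine squeeze_zero_norm (fun k => ?_) hb
      have : inner ℂ (w k) (T (w k)) - inner ℂ (x k) (T (x k))
          = - inner ℂ (F.starProjection (x k)) (T (x k))
            - inner ℂ (w k) (T (F.starProjection (x k))) := by
        simp only [hw, map_sub, inner_sub_left, inner_sub_right]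
        ring
      rw [this]
      refine (norm_sub_le _ _).trans (add_le_add ?_ (norm_inner_le_norm _ _))
      rw [norm_neg]
      refine (norm_inner_le_norm _ _).trans ?_
      gcongr
      simpa [hx.1] using T.le_opNorm (x k)
    simpa using h1.add hlim
  have hq : Tendsto (fun k => inner ℂ (w k) (T (w k)) / ((‖w k‖ : ℂ) ^ 2)) atTop (𝓝 z) := by
    have h1 : Tendsto (fun k => ((‖w k‖ : ℂ)) ^ 2) atTop (𝓝 1) := by
      have := ((Complex.continuous_ofReal.tendsto 1).comp hnorm).pow 2
      simpa using this
    have h2 := hin.div h1 one_ne_zero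
    rw [div_one] at h2
    exact h2
  obtain ⟨k, hk1, hk2⟩ := ((hnorm.eventually_ne one_ne_zero).and
    (Metric.tendsto_nhds.1 hq ε hε)).exists
  refine ⟨((‖w k‖⁻¹ : ℝ) : ℂ) • w k, Submodule.smul_mem _ _ (hwF k), ?_, ?_⟩
  · rw [norm_smul]; simp [hk1]
  · rw [dist_eq_norm] at hk2
    refine lt_of_eq_of_lt (congrArg (fun c => ‖c - z‖) ?_) hk2
    rw [map_smul, inner_smul_left, inner_smul_right, Complex.conj_ofReal]
    push_cast
    field_simp

theorem norm_eq_one_of_inner_self_eq_one {x : H} (h : inner ℂ x x = 1) : ‖x‖ = 1 := by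
  rw [@norm_eq_sqrt_re_inner ℂ, h]
  simp

/-- Take `G` spanned by `F`, `A`, `T A` and `T* A`. All cross terms between `A` and `Gᗮ` then
vanish, so quadratic forms add up without interference. -/
theorem exists_finiteDimensional_decoupling [CompleteSpace H] (T : H →L[ℂ] H)
    (F : Submodule ℂ H) [FiniteDimensional ℂ F] {A : Set H} (hA : A.Finite) :
    ∃ G : Submodule ℂ H, FiniteDimensional ℂ G ∧ ∀ v ∈ Gᗮ, v ∈ Fᗮ ∧ ∀ u ∈ A,
      inner ℂ u v = 0 ∧ inner ℂ v u = 0 ∧ inner ℂ u (T v) = 0 ∧ inner ℂ v (T u) = 0 := by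
  let B : Set H := A ∪ T '' A ∪ ContinuousLinearMap.adjoint T '' A
  have hB : FiniteDimensional ℂ (Submodule.span ℂ B) :=
    FiniteDimensional.span_of_finite ℂ ((hA.union (hA.image _)).union (hA.image _))
  refine ⟨F ⊔ Submodule.span ℂ B, inferInstance, fun v hv => ?_⟩
  have hvB : ∀ b ∈ B, inner ℂ b v = 0 := fun b hb =>
    (Submodule.mem_orthogonal _ v).1 hv b (Submodule.mem_sup_right (Submodule.subset_span hb))
  refine ⟨Submodule.orthogonal_le le_sup_left hv, fun u hu => ⟨?_, ?_, ?_, ?_⟩⟩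
  · exact hvB u (Or.inl (Or.inl hu))
  · exact inner_eq_zero_symm.1 (hvB u (Or.inl (Or.inl hu)))
  · rw [← ContinuousLinearMap.adjoint_inner_left]
    exact hvB _ (Or.inr ⟨u, hu, rfl⟩)
  · exact inner_eq_zero_symm.1 (hvB _ (Or.inl (Or.inr ⟨u, hu, rfl⟩)))

theorem exists_decoupled_family_near [CompleteSpace H] (T : H →L[ℂ] H) {ι : Type*}
    {z : ι → ℂ} (hz : ∀ i, z i ∈ essNumericalRange T) (F : Submodule ℂ H)
    [FiniteDimensional ℂ F] {ε : ℝ} (hε : 0 < ε) (s : Finset ι) :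
    ∃ v : ι → H, (∀ i ∈ s, v i ∈ Fᗮ ∧ ‖v i‖ = 1 ∧ ‖inner ℂ (v i) (T (v i)) - z i‖ < ε) ∧
      ∀ i ∈ s, ∀ j ∈ s, i ≠ j → inner ℂ (v i) (v j) = 0 ∧ inner ℂ (v i) (T (v j)) = 0 := by
  classical
  induction s using Finset.induction_on with
  | empty => exact ⟨0, by simp⟩
  | insert a s ha ih =>
    obtain ⟨v, hv, hvv⟩ := ih
    obtain ⟨G, hG, hGv⟩ := exists_finiteDimensional_decoupling T F (s.finite_toSet.image v)
    obtain ⟨x, hxG, hx1, hx2⟩ := exists_unit_orthogonal_near T (hz a) G hε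
    obtain ⟨hxF, hx⟩ := hGv x hxG
    have hne : ∀ i ∈ s, i ≠ a := fun i hi h => ha (h ▸ hi)
    refine ⟨Function.update v a x, fun i hi => ?_, fun i hi j hj hij => ?_⟩
    · rcases Finset.mem_insert.1 hi with rfl | hi
      · simpa using ⟨hxF, hx1, hx2⟩
      · simpa [Function.update_of_ne (hne i hi)] using hv i hi
    · rcases Finset.mem_insert.1 hi with rfl | his <;>
        rcases Finset.mem_insert.1 hj with rfl | hjs
      · exact absurd rfl hij
      · obtain ⟨-, h2, -, h4⟩ := hx (v j) ⟨j, hjs, rfl⟩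
        simpa [Function.update_of_ne (hne j hjs)] using ⟨h2, h4⟩
      · obtain ⟨h1, -, h3, -⟩ := hx (v i) ⟨i, his, rfl⟩
        simpa [Function.update_of_ne (hne i his)] using ⟨h1, h3⟩
      · simpa [Function.update_of_ne (hne i his), Function.update_of_ne (hne j hjs)]
          using hvv i his j hjs hij

/-- Interior points of the essential numerical range are attained exactly, by unit vectors
orthogonal to any prescribed finite-dimensional subspace. -/
theorem exists_unit_orthogonal_inner_eq [CompleteSpace H] (T : H →L[ℂ] H) {μ : ℂ}
    (hμ : essNumericalRange T ∈ 𝓝 μ) (F : Submodule ℂ H) [FiniteDimensional ℂ F] :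
    ∃ v ∈ Fᗮ, ‖v‖ = 1 ∧ inner ℂ v (T v) = μ := by
  obtain ⟨b, hb1, hb2⟩ := exists_mem_interior_convexHull_affineBasis hμ
  obtain ⟨ε, hε, hball⟩ := Metric.nhds_basis_closedBall.mem_iff.1 (mem_interior_iff_mem_nhds.1 hb1)
  obtain ⟨v, hv, hvv⟩ := exists_decoupled_family_near T (z := b)
    (fun i => hb2 (subset_convexHull ℝ _ ⟨i, rfl⟩)) F (half_pos hε) Finset.univ
  have hmem := mem_convexHull_range_of_perturbation (w := fun i => inner ℂ (v i) (T (v i))) hε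
    hball fun i => (hv i (Finset.mem_univ i)).2.2.le
  rw [convexHull_range_eq_exists_affineCombination] at hmem
  obtain ⟨s, c, hc0, hc1, hc⟩ := hmem
  rw [Finset.affineCombination_eq_linear_combination _ _ _ hc1] at hc
  -- Weights `√(c i)` on decoupled vectors turn the convex combination of values into the value at a
  -- single unit vector.
  have hsq : ∀ i ∈ s, ((√(c i) : ℝ) : ℂ) * ((√(c i) : ℝ) : ℂ) = c i := fun i hi => by
    rw [← Complex.ofReal_mul, Real.mul_self_sqrt (hc0 i hi)]
  have hquad : ∀ L : H →L[ℂ] H, (∀ i j, i ≠ j → inner ℂ (v i) (L (v j)) = 0) →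
      inner ℂ (∑ i ∈ s, ((√(c i) : ℝ) : ℂ) • v i) (L (∑ i ∈ s, ((√(c i) : ℝ) : ℂ) • v i))
        = ∑ i ∈ s, (c i : ℂ) * inner ℂ (v i) (L (v i)) := fun L hL => by
    rw [map_sum, sum_inner]
    refine Finset.sum_congr rfl fun i hi => ?_
    rw [inner_sum, Finset.sum_eq_single_of_mem i hi]
    · rw [map_smul, inner_smul_left, inner_smul_right, Complex.conj_ofReal, ← mul_assoc, hsq i hi]
    · intro j _ hj
      rw [map_smul, inner_smul_left, inner_smul_right, hL i j hj.symm, mul_zero, mul_zero]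
  refine ⟨∑ i ∈ s, ((√(c i) : ℝ) : ℂ) • v i, Submodule.sum_mem _ fun i _ =>
    Submodule.smul_mem _ _ (hv i (Finset.mem_univ i)).1, ?_, ?_⟩
  · have h := hquad (ContinuousLinearMap.id ℂ H)
      fun i j hij => (hvv i (Finset.mem_univ i) j (Finset.mem_univ j) hij).1
    have h1 : ∑ i ∈ s, (c i : ℂ) * inner ℂ (v i) (v i) = 1 := by
      rw [← Complex.ofReal_one, ← hc1, Complex.ofReal_sum]
      refine Finset.sum_congr rfl fun i _ => ?_
      rw [inner_self_eq_norm_sq_to_K, (hv i (Finset.mem_univ i)).2.1]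
      simp
    simp only [ContinuousLinearMap.coe_id', id_eq] at h
    exact norm_eq_one_of_inner_self_eq_one (h.trans h1)
  · rw [hquad T fun i j hij => (hvv i (Finset.mem_univ i) j (Finset.mem_univ j) hij).2, ← hc]
    exact Finset.sum_congr rfl fun i _ => (Complex.real_smul).symm

/-! ### Sufficiency: greedy construction of the basis. -/

/-- Mix the direction `b` of the projection of `y` to `Mᗮ`, with weight `a`, and a decoupled `v`
that corrects the diagonal value. The final bound is stated for all `w` so that it applies to any
vector orthogonal to the finished system. -/
theorem exists_unit_orthogonal_inner_eq_and_le [CompleteSpace H] (T : H →L[ℂ] H)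
    (hT : ‖T‖ ≤ 1) (hWe : Metric.closedBall (0 : ℂ) 1 ⊆ essNumericalRange T)
    (M : Submodule ℂ H) [FiniteDimensional ℂ M] (y : H) {l : ℂ} (hl : ‖l‖ < 1) :
    ∃ e ∈ Mᗮ, ‖e‖ = 1 ∧ inner ℂ e (T e) = l ∧
      ∀ w ∈ Mᗮ, (1 - ‖l‖) / 4 * ‖inner ℂ w y‖ ^ 2 ≤ ‖w‖ ^ 2 * ‖inner ℂ e y‖ ^ 2 := by
  have hnhds : ∀ {μ : ℂ}, ‖μ‖ < 1 → essNumericalRange T ∈ 𝓝 μ := fun {μ} hμ =>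
    mem_of_superset (Metric.isOpen_ball.mem_nhds (by simpa using hμ))
      (Metric.ball_subset_closedBall.trans hWe)
  set q := Mᗮ.starProjection y with hq
  have hqM : q ∈ Mᗮ := Submodule.starProjection_apply_mem _ _
  have hqy : ∀ w ∈ Mᗮ, inner ℂ w y = inner ℂ w q := fun w hw => by
    have h : inner ℂ w (y - q) = 0 :=
      (Submodule.mem_orthogonal _ _).1 (Submodule.sub_starProjection_mem_orthogonal y) w hw
    rwa [inner_sub_right, sub_eq_zero] at h
  rcases eq_or_ne q 0 with hq0 | hq0
  · obtain ⟨e, he, he1, hel⟩ := exists_unit_orthogonal_inner_eq T (hnhds hl) M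
    refine ⟨e, he, he1, hel, fun w hw => ?_⟩
    rw [hqy w hw, hq0, inner_zero_right, norm_zero]
    simp only [ne_eq, OfNat.ofNat_ne_zero, not_false_eq_true, zero_pow, mul_zero]
    positivity
  have hq0' : ‖q‖ ≠ 0 := norm_ne_zero_iff.2 hq0
  set b : H := ((‖q‖⁻¹ : ℝ) : ℂ) • q with hb
  have hb1 : ‖b‖ = 1 := by rw [hb, norm_smul]; simp [hq0']
  have hbM : b ∈ Mᗮ := Submodule.smul_mem _ _ hqM
  have hqb : q = (‖q‖ : ℂ) • b := by
    rw [hb, smul_smul, ← Complex.ofReal_mul, mul_inv_cancel₀ hq0', Complex.ofReal_one, one_smul]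
  set a : ℝ := (1 - ‖l‖) / 4 with ha
  have ha0 : 0 < a := by rw [ha]; linarith
  have ha1 : a ≤ 1 / 4 := by rw [ha]; linarith [norm_nonneg l]
  set β := inner ℂ b (T b) with hβ
  have hβ1 : ‖β‖ ≤ 1 := by
    refine (norm_inner_le_norm _ _).trans ?_
    rw [hb1, one_mul]
    simpa [hb1] using T.le_of_opNorm_le hT b
  have h1a : ((1 - a : ℝ) : ℂ) ≠ 0 := by
    rw [Complex.ofReal_ne_zero]; linarith
  -- The choice of `a` gives `‖l‖ + a = 1 - 3a < 1 - a`, so the value required of `v` stays in the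
  -- open disc.
  have hμ : ‖(l - a * β) / ((1 - a : ℝ) : ℂ)‖ < 1 := by
    rw [norm_div, Complex.norm_real, Real.norm_of_nonneg (by linarith), div_lt_one (by linarith)]
    have h1 : ‖l - a * β‖ ≤ ‖l‖ + a := by
      refine (norm_sub_le _ _).trans ?_
      rw [norm_mul, Complex.norm_real, Real.norm_of_nonneg ha0.le]
      nlinarith
    have : ‖l‖ = 1 - 4 * a := by rw [ha]; ring
    linarith
  obtain ⟨G, hG, hGv⟩ := exists_finiteDimensional_decoupling T M (Set.finite_singleton b)
  obtain ⟨v, hvG, hv1, hvμ⟩ := exists_unit_orthogonal_inner_eq T (hnhds hμ) G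
  obtain ⟨hvM, hvb⟩ := hGv v hvG
  obtain ⟨hbv, hvb, hbTv, hvTb⟩ := hvb b rfl
  have hsa : ((√a : ℝ) : ℂ) * ((√a : ℝ) : ℂ) = a := by
    rw [← Complex.ofReal_mul, Real.mul_self_sqrt ha0.le]
  have hsa' : ((√(1 - a) : ℝ) : ℂ) * ((√(1 - a) : ℝ) : ℂ) = (1 - a : ℝ) := by
    rw [← Complex.ofReal_mul, Real.mul_self_sqrt (by linarith)]
  set e : H := ((√a : ℝ) : ℂ) • b + ((√(1 - a) : ℝ) : ℂ) • v with he
  have heM : e ∈ Mᗮ := Submodule.add_mem _ (Submodule.smul_mem _ _ hbM) (Submodule.smul_mem _ _ hvM)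
  refine ⟨e, heM, ?_, ?_, fun w hw => ?_⟩
  · apply norm_eq_one_of_inner_self_eq_one
    simp only [he, inner_add_left, inner_add_right, inner_smul_left, inner_smul_right,
      Complex.conj_ofReal, hbv, hvb, inner_self_eq_one_of_norm_eq_one hb1,
      inner_self_eq_one_of_norm_eq_one hv1, mul_zero, add_zero, zero_add, mul_one, hsa, hsa']
    push_cast
    ring
  · have : inner ℂ e (T e) = a * β + (1 - a : ℝ) * inner ℂ v (T v) := by
      simp only [he, map_add, map_smul, inner_add_left, inner_add_right, inner_smul_left,
        inner_smul_right, Complex.conj_ofReal, hbTv, hvTb, ← hsa, ← hsa']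
      ring
    rw [this, hvμ, mul_div_cancel₀ _ h1a]
    ring
  · have h1 : inner ℂ e y = ((√a * ‖q‖ : ℝ) : ℂ) := by
      rw [hqy e heM, hqb]
      simp only [he, inner_add_left, inner_smul_left, inner_smul_right, Complex.conj_ofReal, hvb,
        inner_self_eq_norm_sq_to_K, hb1]
      rw [← hqb]
      simp [mul_comm]
    rw [h1, Complex.norm_real, Real.norm_eq_abs, sq_abs, mul_pow, Real.sq_sqrt ha0.le, hqy w hw]
    have h2 : ‖inner ℂ w q‖ ^ 2 ≤ (‖w‖ * ‖q‖) ^ 2 := by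
      gcongr
      exact norm_inner_le_norm _ _
    nlinarith

theorem mem_diagonals_of_tendsto [CompleteSpace H] [TopologicalSpace.SeparableSpace H]
    (T : H →L[ℂ] H) (hT : ‖T‖ ≤ 1)
    (hWe : Metric.closedBall (0 : ℂ) 1 ⊆ essNumericalRange T) (d : ℕ → ℂ) (hd : ∀ k, ‖d k‖ < 1)
    (hsum : Tendsto (fun n => ∑ k ∈ Finset.range n, (1 - ‖d k‖)) atTop atTop) :
    d ∈ diagonals T := by
  obtain ⟨m, hm⟩ := exists_forall_not_summable_indicator_fiber (fun k => 1 - ‖d k‖)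
    (fun k => by linarith [hd k]) (fun k => by linarith [norm_nonneg (d k)]) hsum
  let y : ℕ → H := TopologicalSpace.denseSeq H
  choose φ hφM hφ1 hφd hφ using
    fun (M : {M : Submodule ℂ H // FiniteDimensional ℂ M}) (n : ℕ) =>
      have := M.2
      exists_unit_orthogonal_inner_eq_and_le T hT hWe M.1 (y (m n)) (hd n)
  let M : ℕ → {M : Submodule ℂ H // FiniteDimensional ℂ M} := fun n =>
    Nat.rec ⟨⊥, inferInstance⟩ (fun n M => ⟨M.1 ⊔ Submodule.span ℂ {φ M n}, by
      have := M.2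
      infer_instance⟩) n
  let e : ℕ → H := fun n => φ (M n) n
  have hM : ∀ n, (M (n + 1)).1 = (M n).1 ⊔ Submodule.span ℂ {e n} := fun n => rfl
  have hmono : Monotone fun n => (M n).1 := monotone_nat_of_le_succ fun n => by
    rw [hM]; exact le_sup_left
  have hlt : ∀ i j, i < j → inner ℂ (e i) (e j) = 0 := fun i j hij => by
    refine (Submodule.mem_orthogonal _ _).1 (hφM (M j) j) (e i) (hmono (Nat.succ_le_of_lt hij) ?_)
    change e i ∈ (M (i + 1)).1
    rw [hM]
    exact Submodule.mem_sup_right (Submodule.mem_span_singleton_self _)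
  have ho : Orthonormal ℂ e := by
    refine ⟨fun n => hφ1 _ _, fun i j hij => ?_⟩
    rcases lt_or_gt_of_ne hij with h | h
    · exact hlt i j h
    · exact inner_eq_zero_symm.1 (hlt j i h)
  have hMspan : ∀ n, (M n).1 ≤ Submodule.span ℂ (Set.range e) := fun n => by
    induction n with
    | zero => exact bot_le
    | succ n ih =>
      rw [hM]
      exact sup_le ih (Submodule.span_mono (Set.singleton_subset_iff.2 ⟨n, rfl⟩))
  have hbot : (Submodule.span ℂ (Set.range e))ᗮ = ⊥ := by
    rw [Submodule.eq_bot_iff]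
    intro w hw
    -- If `⟨w, y i⟩ ≠ 0`, Bessel for `y i` would make `1 - ‖d k‖` summable over the steps `k` with
    -- target `y i`.
    have hwy : ∀ i, inner ℂ w (y i) = 0 := fun i => by
      by_contra hne
      have hpos : 0 < ‖inner ℂ w (y i)‖ ^ 2 := by positivity
      refine hm i (Summable.of_nonneg_of_le (fun k => ?_) (fun k => ?_)
        ((ho.inner_products_summable (y i)).mul_left (4 * ‖w‖ ^ 2 / ‖inner ℂ w (y i)‖ ^ 2)))
      · exact Set.indicator_nonneg (fun k _ => by linarith [hd k]) k
      · by_cases hk : m k = i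
        · rw [Set.indicator_of_mem (show k ∈ {n | m n = i} from hk)]
          have h := hφ (M k) k w (Submodule.orthogonal_le (hMspan k) hw)
          rw [hk] at h
          rw [div_mul_eq_mul_div, le_div_iff₀ hpos]
          change _ ≤ ‖w‖ ^ 2 * ‖inner ℂ (e k) (y i)‖ ^ 2 at h
          linarith
        · rw [Set.indicator_of_notMem (show k ∉ {n | m n = i} from hk)]
          positivity
    have hall : (fun x => inner ℂ w x) = fun _ => (0 : ℂ) :=
      Continuous.ext_on (TopologicalSpace.denseRange_denseSeq H) (by fun_prop) continuous_const
        (by rintro _ ⟨i, rfl⟩; exact hwy i)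
    exact inner_self_eq_zero.1 (congrFun hall w)
  refine ⟨HilbertBasis.mkOfOrthogonalEqBot ho hbot, fun k => ?_⟩
  rw [HilbertBasis.coe_mkOfOrthogonalEqBot]
  exact hφd _ _

end OperatorDiagonals

theorem mainTheorem11 {H : Type*} [NormedAddCommGroup H] [InnerProductSpace ℂ H]
    [CompleteSpace H] [TopologicalSpace.SeparableSpace H] (hH : ¬ FiniteDimensional ℂ H)
    (T : H →L[ℂ] H) (hT : ‖T‖ ≤ 1)
    (hWe : OperatorDiagonals.essNumericalRange T = Metric.closedBall (0 : ℂ) 1)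
    (hFred : ¬ (T.IsFredholm ∧ OperatorDiagonals.fredholmIndex T = 0))
    (d : ℕ → ℂ) (hd : ∀ k, ‖d k‖ < 1) :
    d ∈ OperatorDiagonals.diagonals T ↔
      Tendsto (fun n => ∑ k ∈ Finset.range n, (1 - ‖d k‖)) atTop atTop := by
  refine ⟨?_, OperatorDiagonals.mem_diagonals_of_tendsto T hT hWe.ge d hd⟩
  rintro ⟨e, he⟩
  rw [← not_summable_iff_tendsto_nat_atTop_of_nonneg fun k => by linarith [hd k]]
  intro hs
  exact hFred (OperatorDiagonals.isFredholm_index_zero_of_summable T hT e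
    (by simpa only [he] using hs))
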